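/- Let $k$ be a field, let $D$ be a semisimple $k$-algebra which is finitely generated as a module over its centre $K$, and let $\sigma$ be a $k$-algebra automorphism of $D$. Let $D[t;\sigma]=\bigoplus_{n\ge 0} D\,t^n$ be the skew polynomial ring, in which $t d=\sigma(d)t$ for $d\in D$, graded by the degree in $t$. Let $A$ be a graded $k$-subalgebra of $D[t;\sigma]$, i.e. $A=\bigoplus_n (A\cap D\,t^n)$, which is semiprime and (left and right) noetherian as a ring, and let $X$ be the set of homogeneous regular elements (non-zero-divisors) of $A$. Suppose that $A$ has a graded quotient ring with respect to $X$, i.e. that $X$ satisfies the right Ore condition: for all $a\in A$ and $x\in X$ there are $b\in A$ and $y\in X$ with $ay=xb$. Then $A$ is birationally PI: the degree zero part $$Q(A)_0=\{a x^{-1} : a\in A_n,\ x\in A_n\cap X,\ n\ge 0\}$$ of the graded quotient ring $Q(A)=AX^{-1}$ is a PI algebra, that is, it satisfies a nonzero polynomial identity with coefficients in $k$ in noncommuting variables. -/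

import Mathlib

universe u

noncomputable section

/-! ## Skew polynomial rings -/

section SkewPolynomialRing

variable {k D : Type*} [Field k] [Ring D] [Algebra k D]

/-- The action of the monoid `ℕ` (written multiplicatively) on `D` in which `n` acts as `σ ^ n`. -/
@[reducible]
def powersAction (σ : D ≃ₐ[k] D) : MulSemiringAction (Multiplicative ℕ) D :=
  MulSemiringAction.compHom D (powersHom (D ≃ₐ[k] D) σ)

/-- The skew polynomial ring `D[t;σ]`, with elements the left polynomials `∑ dₙ tⁿ` and with
multiplication determined by `t d = σ(d) t`: Mathlib's `SkewPolynomial` for the action of the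
powers of `σ`. -/
def SkewPolyRing (_σ : D ≃ₐ[k] D) := SkewPolynomial D

namespace SkewPolyRing

variable (σ : D ≃ₐ[k] D)

instance : Ring (SkewPolyRing σ) :=
  letI := powersAction σ
  (inferInstance : Ring (SkewPolynomial D))

instance : Algebra k (SkewPolyRing σ) :=
  letI := powersAction σ
  haveI : SMulCommClass (Multiplicative ℕ) k D :=
    ⟨fun n c d => map_smul (powersHom (D ≃ₐ[k] D) σ n) c d⟩
  (inferInstance : Algebra k (SkewPolynomial D))

/-- The element `d tⁿ` of `D[t;σ]`. -/
def monomial (n : ℕ) (d : D) : SkewPolyRing σ := SkewPolynomial.monomial n d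

theorem monomial_mul_monomial (m n : ℕ) (c d : D) :
    monomial σ m c * monomial σ n d = monomial σ (m + n) (c * (σ ^ m) d) := by
  let _ := powersAction σ
  have h := SkewPolynomial.monomial_mul_monomial m n c d
  rw [SkewPolynomial.φ_iterate_apply] at h
  exact h

theorem monomial_add (n : ℕ) (c d : D) :
    monomial σ n (c + d) = monomial σ n c + monomial σ n d :=
  SkewPolynomial.monomial_add n c d

theorem smul_monomial (n : ℕ) (c : k) (d : D) :
    c • monomial σ n d = monomial σ n (c • d) :=
  SkewPolynomial.smul_monomial n c d

/-- The homogeneous component `D tⁿ` of degree `n` of `D[t;σ]`. -/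
def homogeneousPart (n : ℕ) : Submodule k (SkewPolyRing σ) where
  carrier := Set.range (monomial σ n)
  add_mem' := by
    rintro _ _ ⟨c, rfl⟩ ⟨d, rfl⟩
    exact ⟨c + d, monomial_add σ n c d⟩
  zero_mem' := ⟨0, SkewPolynomial.monomial_zero_right n⟩
  smul_mem' := by
    rintro c _ ⟨d, rfl⟩
    exact ⟨c • d, (smul_monomial σ n c d).symm⟩

/-- For a subalgebra `A` of `D[t;σ]`, the piece `A ∩ D tⁿ`, as a subspace of `A`. The subalgebra
`A` is a graded subalgebra if and only if it is graded by these pieces, i.e. `A = ⨁ₙ (A ∩ D tⁿ)`. -/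
def gradedPiece {σ : D ≃ₐ[k] D} (A : Subalgebra k (SkewPolyRing σ)) (n : ℕ) : Submodule k A :=
  (homogeneousPart σ n).comap A.val.toLinearMap

end SkewPolyRing

end SkewPolynomialRing

/-! ## Ring-theoretic notions -/

/-- A ring is semiprime if it has no nonzero (two-sided) ideal `I` with `I ^ 2 = 0`; products of
ideals being generated by products of elements, this says that `x y = 0` for all `x, y ∈ I` forces
`I = 0`. -/
def IsSemiprimeRing (R : Type*) [Ring R] : Prop :=
  ∀ I : TwoSidedIdeal R, (∀ x ∈ I, ∀ y ∈ I, x * y = 0) → I = ⊥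

/-- A ring is noetherian if it is left and right noetherian. -/
def IsTwoSidedNoetherianRing (R : Type*) [Ring R] : Prop :=
  IsNoetherianRing R ∧ IsNoetherianRing Rᵐᵒᵖ

/-- A `k`-algebra is PI if it satisfies a polynomial identity: some nonzero polynomial over `k` in
noncommuting variables vanishes under all substitutions of elements of the algebra. -/
def IsPIAlgebra (k R : Type*) [Field k] [Ring R] [Algebra k R] : Prop :=
  ∃ p : FreeAlgebra k ℕ, p ≠ 0 ∧ ∀ v : ℕ → R, FreeAlgebra.lift k v p = 0

/-! ## The graded quotient ring -/

section GradedQuotientRing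

variable {k A : Type*} [Field k] [Ring A] [Algebra k A]

/-- The multiplicative set of homogeneous regular elements of a graded algebra. -/
def homogeneousRegular (𝒜 : ℕ → Submodule k A) [GradedAlgebra 𝒜] : Submonoid A where
  carrier := {x | SetLike.IsHomogeneousElem 𝒜 x ∧ x ∈ nonZeroDivisors A}
  one_mem' := ⟨⟨0, SetLike.GradedOne.one_mem⟩, one_mem _⟩
  mul_mem' := by
    rintro x y ⟨⟨m, hm⟩, hx⟩ ⟨⟨n, hn⟩, hy⟩
    exact ⟨⟨m + n, SetLike.GradedMul.mul_mem hm hn⟩, mul_mem hx hy⟩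

/-- The right Ore condition on a multiplicative set `X`: any `a ∈ A` and `x ∈ X` have a common
right multiple `a y = x b` with `y ∈ X`. -/
def IsRightOre (X : Submonoid A) : Prop :=
  ∀ a : A, ∀ x ∈ X, ∃ b : A, ∃ y ∈ X, a * y = x * b

variable {Q : Type*} [Ring Q] [Algebra k Q]

/-- `ι : A → Q` exhibits `Q` as the graded quotient ring `A X⁻¹` of `A`, where `X` is the set of
homogeneous regular elements of `A`: the map `ι` is injective, it makes all elements of `X`
invertible, and every element of `Q` is of the form `a x⁻¹`. -/
structure IsGradedQuotientRing (𝒜 : ℕ → Submodule k A) [GradedAlgebra 𝒜] (ι : A →ₐ[k] Q) :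
    Prop where
  injective : Function.Injective ι
  isUnit : ∀ x ∈ homogeneousRegular 𝒜, IsUnit (ι x)
  surj : ∀ q : Q, ∃ a : A, ∃ x ∈ homogeneousRegular 𝒜, q * ι x = ι a

namespace IsGradedQuotientRing

variable {𝒜 : ℕ → Submodule k A} [GradedAlgebra 𝒜] {ι : A →ₐ[k] Q}

/-- A homogeneous form of the right Ore condition: if `x ∈ X` has degree `n` and `a` has degree
`m`, then `a y = x b` with `y ∈ X` of some degree `j` and `b` of degree `m + j - n`. -/
theorem exists_ore (h : IsGradedQuotientRing 𝒜 ι) {m n : ℕ} {a x : A} (ha : a ∈ 𝒜 m)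
    (hx : x ∈ 𝒜 n) (hxX : x ∈ homogeneousRegular 𝒜) :
    ∃ j : ℕ, ∃ b : A, ∃ y ∈ 𝒜 j, y ∈ homogeneousRegular 𝒜 ∧ a * y = x * b ∧
      ∀ c ∈ 𝒜 n, c * b ∈ 𝒜 (m + j) := by
  obtain ⟨u, hu⟩ := h.isUnit x hxX
  obtain ⟨b, y, hyX, hb⟩ := h.surj (↑u⁻¹ * ι a)
  have hay : a * y = x * b := by
    apply h.injective
    rw [map_mul, map_mul, hb.symm, hu.symm]
    simp [← mul_assoc]
  obtain ⟨j, hy⟩ := hyX.1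
  have hayj : x * b ∈ 𝒜 (m + j) := hay ▸ SetLike.GradedMul.mul_mem ha hy
  refine ⟨j, b, y, hy, hyX, hay, fun c hc => ?_⟩
  classical
  have key : ∀ i, n + i ≠ m + j → (DirectSum.decompose 𝒜 b i : A) = 0 := by
    intro i hi
    refine hxX.2.1 _ ?_
    rw [← DirectSum.coe_decompose_mul_add_of_left_mem 𝒜 hx]
    exact DirectSum.decompose_of_mem_ne 𝒜 hayj hi.symm
  rw [← DirectSum.sum_support_decompose 𝒜 b, Finset.mul_sum]
  refine Submodule.sum_mem _ fun i _ => ?_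
  by_cases hi : n + i = m + j
  · rw [← hi]
    exact SetLike.GradedMul.mul_mem hc (SetLike.coe_mem _)
  · rw [key i hi, mul_zero]
    exact zero_mem _

/-- The degree zero part of the graded quotient ring: the elements `a x⁻¹` with `a` and `x`
homogeneous of the same degree and `x` regular. -/
def degreeZero (h : IsGradedQuotientRing 𝒜 ι) : Subalgebra k Q where
  carrier := {q | ∃ n : ℕ, ∃ a ∈ 𝒜 n, ∃ x ∈ 𝒜 n, x ∈ homogeneousRegular 𝒜 ∧ q * ι x = ι a}
  mul_mem' := by
    rintro q r ⟨m, a, ha, x, hx, hxX, hq⟩ ⟨n, b, hb, y, hy, hyX, hr⟩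
    obtain ⟨j, c, z, hz, hzX, hc, hdeg⟩ := h.exists_ore hb hx hxX
    refine ⟨n + j, a * c, hdeg a ha, y * z, SetLike.GradedMul.mul_mem hy hz,
      mul_mem hyX hzX, ?_⟩
    calc q * r * ι (y * z) = q * (r * ι y) * ι z := by rw [map_mul]; simp only [mul_assoc]
      _ = q * ι (b * z) := by rw [hr, map_mul, mul_assoc]
      _ = ι (a * c) := by rw [hc, map_mul, ← mul_assoc, hq, map_mul]
  add_mem' := by
    rintro q r ⟨m, a, ha, x, hx, hxX, hq⟩ ⟨n, b, hb, y, hy, hyX, hr⟩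
    obtain ⟨j, c, z, hz, hzX, hc, hdeg⟩ := h.exists_ore hy hx hxX
    refine ⟨n + j, a * c + b * z, add_mem (hdeg a ha) (SetLike.GradedMul.mul_mem hb hz), y * z,
      SetLike.GradedMul.mul_mem hy hz, mul_mem hyX hzX, ?_⟩
    rw [add_mul, map_add]
    congr 1
    · rw [hc, map_mul, ← mul_assoc, hq, map_mul]
    · rw [map_mul, ← mul_assoc, hr, map_mul]
  algebraMap_mem' c :=
    ⟨0, algebraMap k A c, SetLike.algebraMap_mem_graded 𝒜 c, 1, SetLike.GradedOne.one_mem,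
      one_mem _, by rw [map_one, mul_one, AlgHom.commutes]⟩

end IsGradedQuotientRing

end GradedQuotientRing

/-- A graded algebra `A` is birationally PI if it has a graded quotient ring `Q(A) = A X⁻¹`, with
`X` the homogeneous regular elements, and the degree zero part `Q(A)₀` is PI. (The graded quotient
ring is unique up to a unique isomorphism over `A`.) -/
def IsBirationallyPI {k : Type*} {A : Type u} [Field k] [Ring A] [Algebra k A]
    (𝒜 : ℕ → Submodule k A) [GradedAlgebra 𝒜] : Prop :=
  ∃ (Q : Type u) (_ : Ring Q) (_ : Algebra k Q) (ι : A →ₐ[k] Q)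
    (h : IsGradedQuotientRing 𝒜 ι), IsPIAlgebra k h.degreeZero

end

/-! ## Standard identities -/

section StandardIdentity

/-! The ring `D` satisfies a standard identity `p`, and a power `tᴺ` carries `p` over to `Q(A)₀`.
Let `T n` be the left ideal of those `c` for which some element of `X` kills `c tⁿ` on the right.
Right multiplication by an element of `X` of degree `p` embeds `D ⧸ T N` into `D ⧸ T (N + p)`; if `D
⧸ T N` has maximal length, all these embeddings are onto. Given `q = a x⁻¹` of degree zero,
surjectivity for `x` yields `d` in `D` with `tᴺ a = d tᴺ x` up to a right factor from `X`, that is,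
`tᴺ q = d tᴺ`. Such relations can be added and multiplied, so `tᴺ p(q₁, …) = p(d₁, …) tᴺ = 0`. Since
`tᴺ` is left cancellable, `p` vanishes on `Q(A)₀`. -/

/-- The standard polynomial `∑ sign(π) x_{π 1} ⋯ x_{π n}` in noncommuting variables. -/
def standardPolynomial (k : Type*) [Field k] (n : ℕ) : FreeAlgebra k ℕ :=
  ∑ π : Equiv.Perm (Fin n),
    ((Equiv.Perm.sign π : ℤ) : k) • (List.ofFn fun i => FreeAlgebra.ι k (π i : ℕ)).prod

theorem standardPolynomial_ne_zero (k : Type*) [Field k] (n : ℕ) :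
    standardPolynomial k n ≠ 0 := by
  classical
  intro h
  have hπ (π : Equiv.Perm (Fin n)) :
      FreeAlgebra.equivMonoidAlgebraFreeMonoid
        (List.ofFn fun i => FreeAlgebra.ι k (π i : ℕ)).prod =
      MonoidAlgebra.single (FreeMonoid.ofList (List.ofFn fun i => (π i : ℕ))) (1 : k) := by
    rw [← AlgEquiv.eq_symm_apply]
    simp [FreeAlgebra.equivMonoidAlgebraFreeMonoid, FreeMonoid.lift_apply, List.map_ofFn,
      Function.comp_def]
  -- Only the identity permutation contributes to the coefficient of `x₀ ⋯ xₙ₋₁`, which is therefore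
  -- 1.
  have h1 := congrArg (fun p : FreeAlgebra k ℕ => (FreeAlgebra.equivMonoidAlgebraFreeMonoid p).coeff
    (FreeMonoid.ofList (List.ofFn fun i : Fin n => (i : ℕ)))) h
  have hword (π : Equiv.Perm (Fin n)) :
      FreeMonoid.ofList (List.ofFn fun i => (π i : ℕ)) =
        FreeMonoid.ofList (List.ofFn fun i : Fin n => (i : ℕ)) ↔ π = 1 := by
    rw [FreeMonoid.ofList.injective.eq_iff, List.ofFn_injective.eq_iff, funext_iff, Equiv.ext_iff]
    simp [Fin.val_inj]
  simp [standardPolynomial, hπ, Finsupp.single_apply, hword] at h1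

/-- An algebra which is finitely generated as a module over its centre satisfies a standard
identity. -/
theorem isPIAlgebra_of_finite_center (k D : Type*) [Field k] [Ring D] [Algebra k D]
    [Module.Finite (Subalgebra.center k D) D] : IsPIAlgebra k D := by
  obtain ⟨m, g, hg⟩ := Module.Finite.exists_fin (R := Subalgebra.center k D) (M := D)
  refine ⟨standardPolynomial k (m + 1), standardPolynomial_ne_zero k _, fun v => ?_⟩
  let _ : Algebra (Subalgebra.center k D) D := Algebra.ofModule smul_mul_assoc fun c x y => by
    simp only [Subalgebra.smul_def, smul_eq_mul, ← mul_assoc, (Subalgebra.mem_center_iff.1 c.2 x)]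
  let f := MultilinearMap.alternatization
    (MultilinearMap.mkPiAlgebraFin (Subalgebra.center k D) (m + 1) D)
  have hf : FreeAlgebra.lift k v (standardPolynomial k (m + 1)) = f fun i => v i := by
    simp [standardPolynomial, f, MultilinearMap.alternatization_apply, List.map_ofFn,
      Function.comp_def, map_list_prod, Units.smul_def, Int.cast_smul_eq_zsmul]
  have hspan (i : Fin (m + 1)) :
      ∃ c : Fin m → Subalgebra.center k D, ∑ j, c j • g j = v i :=
    (Submodule.mem_span_range_iff_exists_fun _).1 (hg ▸ Submodule.mem_top)
  choose c hc using hspan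
  rw [hf, ← funext hc]
  change f.toMultilinearMap _ = 0
  rw [MultilinearMap.map_sum f.toMultilinearMap]
  refine Finset.sum_eq_zero fun r _ => ?_
  -- There are `m + 1` arguments and only `m` generators, so every term repeats a generator.
  rw [MultilinearMap.map_smul_univ f.toMultilinearMap, AlternatingMap.coe_multilinearMap,
    f.map_eq_zero_of_not_injective, smul_zero]
  intro hinj
  have hr : Function.Injective r := fun i j hij => hinj (by simp [hij])
  simpa using Fintype.card_le_of_injective r hr

end StandardIdentity

/-! ## Modules of finite length -/

theorem LinearMap.surjective_of_injective_of_length_le {R M N : Type*} [Ring R] [AddCommGroup M]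
    [Module R M] [AddCommGroup N] [Module R N] (f : M →ₗ[R] N) (hf : Function.Injective f)
    (hN : Module.length R N ≠ ⊤) (h : Module.length R N ≤ Module.length R M) :
    Function.Surjective f := by
  have hl := Module.length_eq_add_of_exact f (LinearMap.range f).mkQ hf
    (Submodule.mkQ_surjective _) (LinearMap.exact_iff.2 (by simp))
  have hM : Module.length R M ≠ ⊤ := fun h' => hN (by rw [hl, h', top_add])
  rw [hl] at h
  have h0 : Module.length R (N ⧸ LinearMap.range f) = 0 := by
    have : Module.length R M + Module.length R (N ⧸ LinearMap.range f) ≤ Module.length R M + 0 := by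
      simpa using h
    simpa using (ENat.add_le_add_iff_left hM).1 this
  rw [Module.length_eq_zero_iff, Submodule.Quotient.subsingleton_iff] at h0
  exact LinearMap.range_eq_top.1 h0

/-- Among a sequence of left ideals `T n` of a ring of finite length there is a `T N` such that any
right multiplication inducing an injection `D ⧸ T N → D ⧸ T m` induces a surjection. -/
theorem exists_index_forall_right_mul_surjective {D : Type*} [Ring D] [IsSemisimpleRing D]
    (T : ℕ → Submodule D D) :
    ∃ N, ∀ m e, (∀ c, c ∈ T N ↔ c * e ∈ T m) → ∀ a, ∃ c, c * e - a ∈ T m := by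
  -- As `D` has finite length, minimal length of `T N` means maximal length of `D ⧸ T N`.
  let N := Function.argmin fun n => Module.length D (T n)
  refine ⟨N, fun m e he a => ?_⟩
  have hD : Module.length D D ≠ ⊤ := Module.length_ne_top
  have hlen (n : ℕ) : Module.length D D = Module.length D (T n) + Module.length D (D ⧸ T n) :=
    Module.length_eq_add_of_exact (T n).subtype (T n).mkQ (T n).subtype_injective
      (T n).mkQ_surjective (LinearMap.exact_subtype_mkQ _)
  have hle : Module.length D (D ⧸ T m) ≤ Module.length D (D ⧸ T N) := by
    have h1 : Module.length D (T N) ≤ Module.length D (T m) := Function.argmin_le (f := fun n => Module.length D (T n)) m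
    have hN : Module.length D (T N) ≠ ⊤ := fun h => hD (by rw [hlen N, h, top_add])
    rw [← ENat.add_le_add_iff_left hN, ← hlen N, hlen m]
    gcongr
  let f : D ⧸ T N →ₗ[D] D ⧸ T m :=
    (T N).mapQ (T m) (LinearMap.toSpanSingleton D D e) fun c hc => (he c).1 hc
  have hf : Function.Injective f := by
    rw [← LinearMap.ker_eq_bot, LinearMap.ker_eq_bot']
    rintro ⟨c⟩ hc
    exact (Submodule.Quotient.mk_eq_zero _).2 ((he c).2 ((Submodule.Quotient.mk_eq_zero _).1 hc))
  have hQ : Module.length D (D ⧸ T m) ≠ ⊤ := fun h => hD (by rw [hlen m, h, add_top])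
  obtain ⟨⟨c⟩, hc⟩ := f.surjective_of_injective_of_length_le hf hQ hle (Submodule.Quotient.mk a)
  exact ⟨c, (Submodule.Quotient.eq _).1 hc⟩

/-! ## Right Ore localization -/

section RightOre

variable {k : Type*} {A : Type u} [Field k] [Ring A] [Algebra k A]

/-- A graded algebra whose homogeneous regular elements satisfy the right Ore condition has a
graded quotient ring. -/
theorem exists_isGradedQuotientRing (𝒜 : ℕ → Submodule k A) [GradedAlgebra 𝒜]
    (hOre : IsRightOre (homogeneousRegular 𝒜)) :
    ∃ (Q : Type u) (_ : Ring Q) (_ : Algebra k Q) (ι : A →ₐ[k] Q), IsGradedQuotientRing 𝒜 ι := by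
  let X := homogeneousRegular 𝒜
  have hreg (x : A) (hx : x ∈ X) : x ∈ nonZeroDivisors A := hx.2
  -- `OreLocalization` forms left fractions; right fractions of `A` are left fractions of `Aᵐᵒᵖ`,
  -- read in the opposite ring.
  have hne : Nonempty (OreLocalization.OreSet X.op) := by
    rw [OreLocalization.nonempty_oreSet_iff]
    refine ⟨fun r₁ r₂ s h => ⟨s, ?_⟩, fun r s => ?_⟩
    · have hs := (hreg _ s.2).1
      have : r₁.unop = r₂.unop := by
        rw [← sub_eq_zero]
        refine hs _ ?_
        rw [mul_sub, sub_eq_zero]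
        exact congrArg MulOpposite.unop h
      rw [MulOpposite.unop_injective this]
    · obtain ⟨b, y, hy, hb⟩ := hOre r.unop s.1.unop s.2
      exact ⟨MulOpposite.op b, ⟨MulOpposite.op y, hy⟩, MulOpposite.unop_injective hb⟩
  obtain ⟨_⟩ := hne
  let L := OreLocalization X.op Aᵐᵒᵖ
  let num : Aᵐᵒᵖ →+* L := OreLocalization.numeratorRingHom
  let ι : A →ₐ[k] Lᵐᵒᵖ :=
    { toFun := fun a => MulOpposite.op (num (MulOpposite.op a))
      map_one' := by simp
      map_mul' := fun a b => by rw [MulOpposite.op_mul, map_mul, MulOpposite.op_mul]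
      map_zero' := by simp
      map_add' := fun a b => by simp
      commutes' := fun c => rfl }
  refine ⟨Lᵐᵒᵖ, inferInstance, inferInstance, ι, ?_, ?_, ?_⟩
  · intro a b hab
    refine MulOpposite.op_injective (OreLocalization.numeratorHom_inj (S := X.op) ?_
      (MulOpposite.op_injective hab))
    intro x hx y hxy
    exact MulOpposite.unop_injective ((hreg _ hx).2 _ (congrArg MulOpposite.unop hxy))
  · intro x hx
    exact (OreLocalization.numerator_isUnit (S := X.op) ⟨MulOpposite.op x, hx⟩).op
  · intro q
    induction hq : q.unop using OreLocalization.ind with | _ r s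
    refine ⟨r.unop, s.1.unop, s.2, MulOpposite.unop_injective ?_⟩
    change OreLocalization.numeratorHom (s : Aᵐᵒᵖ) * q.unop = OreLocalization.numeratorHom r
    rw [hq, OreLocalization.numeratorHom_apply, OreLocalization.numeratorHom_apply,
      OreLocalization.mul_cancel]

end RightOre

/-! ### Torsion coefficients and intertwining by `tᴺ` -/

namespace SkewPolyRing

variable {k D : Type*} [Field k] [Ring D] [Algebra k D] (σ : D ≃ₐ[k] D)

/-- Left multiplication by `tⁿ` shifts exponents and applies the injective map `σ ^ n` to each
coefficient. -/
theorem eq_zero_of_monomial_one_mul_eq_zero {n : ℕ} {f : SkewPolyRing σ}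
    (h : monomial σ n 1 * f = 0) : f = 0 := by
  let _ := powersAction σ
  let g : SkewMonoidAlgebra D (Multiplicative ℕ) := f
  have h2 : SkewMonoidAlgebra.single (Multiplicative.ofAdd n) (1 : D) * g = 0 := h
  apply SkewMonoidAlgebra.ext
  intro m
  have h1 := SkewMonoidAlgebra.coeff_single_mul_aux g (r := 1)
    (x := Multiplicative.ofAdd n) fun a => mul_right_inj (b := a) (c := m) _
  rw [h2, one_mul] at h1
  exact (map_eq_zero_iff (σ ^ n) (σ ^ n).injective).1 h1.symm

theorem monomial_sub (n : ℕ) (c d : D) :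
    monomial σ n (c - d) = monomial σ n c - monomial σ n d := by
  rw [eq_sub_iff_add_eq, ← monomial_add, sub_add_cancel]

theorem monomial_zero (n : ℕ) : monomial σ n 0 = 0 := SkewPolynomial.monomial_zero_right n

theorem monomial_zero_mul_monomial_one (n : ℕ) (d : D) :
    monomial σ 0 d * monomial σ n 1 = monomial σ n d := by
  rw [monomial_mul_monomial, map_one, mul_one, zero_add]

variable {σ} (A : Subalgebra k (SkewPolyRing σ)) (X : Submonoid A)

/-- The left ideal of the coefficients `c` for which `c tⁿ` is annihilated on the right by an
element of the right Ore set `X`. -/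
def torsionCoeff (hX : IsRightOre X) (n : ℕ) : Submodule D D where
  carrier := {c | ∃ z ∈ X, monomial σ n c * (z : A) = 0}
  add_mem' := by
    rintro c d ⟨y, hy, hc⟩ ⟨z, hz, hd⟩
    -- The common multiple `y u = z w` kills both terms.
    obtain ⟨w, u, hu, h⟩ := hX y z hz
    refine ⟨y * u, mul_mem hy hu, ?_⟩
    rw [monomial_add, add_mul]
    nth_rw 2 [h]
    push_cast
    rw [← mul_assoc, hc, ← mul_assoc, hd, zero_mul, zero_mul, add_zero]
  zero_mem' := ⟨1, one_mem _, by rw [monomial_zero, zero_mul]⟩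
  smul_mem' := by
    rintro d c ⟨z, hz, hc⟩
    refine ⟨z, hz, ?_⟩
    have : monomial σ n (d * c) = monomial σ 0 d * monomial σ n c := by
      simp [monomial_mul_monomial]
    rw [smul_eq_mul, this, mul_assoc, hc, mul_zero]

theorem mem_torsionCoeff {hX : IsRightOre X} {n : ℕ} {c : D} :
    c ∈ torsionCoeff A X hX n ↔ ∃ z ∈ X, monomial σ n c * (z : A) = 0 := Iff.rfl

/-- This makes right multiplication by `y` well defined and injective modulo torsion. If `z` kills
`c tⁿ` and `y u = z w`, then `u` kills `c tⁿ y`; conversely, if `z` kills `c tⁿ y`, then `y z` kills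
`c tⁿ`. -/
theorem mem_torsionCoeff_iff_mul_mem (hX : IsRightOre X) {y : A} (hy : y ∈ X) {p : ℕ} {e : D}
    (he : monomial σ p e = y) (n : ℕ) (c : D) :
    c ∈ torsionCoeff A X hX n ↔ c * (σ ^ n) e ∈ torsionCoeff A X hX (n + p) := by
  simp only [mem_torsionCoeff, ← monomial_mul_monomial, he]
  constructor
  · rintro ⟨z, hz, hc⟩
    obtain ⟨w, u, hu, h⟩ := hX y z hz
    refine ⟨u, hu, ?_⟩
    have h' := congrArg (Subtype.val) h
    push_cast at h'
    rw [mul_assoc, h', ← mul_assoc, hc, zero_mul]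
  · rintro ⟨z, hz, hc⟩
    exact ⟨y * z, mul_mem hy hz, by rw [← hc]; push_cast; rw [mul_assoc]⟩

variable {A X} {Q : Type*} [Ring Q] [Algebra k Q]

/-- `IntertwinesAt X ι N d q` expresses the relation `tᴺ q = d tᴺ` between a coefficient `d` and a
right fraction `q = a x⁻¹`. -/
def IntertwinesAt (X : Submonoid A) (ι : A →ₐ[k] Q) (N : ℕ) (d : D) (q : Q) : Prop :=
  ∃ a : A, ∃ x ∈ X, q * ι x = ι a ∧ monomial σ N 1 * (a : SkewPolyRing σ) = monomial σ N d * (x : A)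

namespace IntertwinesAt

variable {ι : A →ₐ[k] Q} {N : ℕ} {d d' : D} {q q' : Q}

theorem of_algebraMap (c : k) :
    IntertwinesAt X ι N (algebraMap k D c) (algebraMap k Q c) := by
  refine ⟨algebraMap k A c, 1, one_mem _, by simp, ?_⟩
  simp [Algebra.algebraMap_eq_smul_one, ← smul_monomial]

theorem add (hX : IsRightOre X) (h : IntertwinesAt X ι N d q) (h' : IntertwinesAt X ι N d' q') :
    IntertwinesAt X ι N (d + d') (q + q') := by
  obtain ⟨a, x, hx, hq, hd⟩ := h
  obtain ⟨b, y, hy, hq', hd'⟩ := h'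
  -- Common denominator `x u = y w`.
  obtain ⟨w, u, hu, hw⟩ := hX x y hy
  refine ⟨a * u + b * w, x * u, mul_mem hx hu, ?_, ?_⟩
  · rw [add_mul, map_add, map_mul ι a, ← hq, map_mul ι b, ← hq', mul_assoc q', ← map_mul, ← hw,
      mul_assoc, ← map_mul]
  · have hw' := congrArg Subtype.val hw
    push_cast at hw' ⊢
    rw [mul_add, ← mul_assoc, hd, ← mul_assoc, hd', monomial_add, add_mul, mul_assoc, mul_assoc,
      hw']

theorem mul (hX : IsRightOre X) (h : IntertwinesAt X ι N d q) (h' : IntertwinesAt X ι N d' q') :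
    IntertwinesAt X ι N (d * d') (q * q') := by
  obtain ⟨a, x, hx, hq, hd⟩ := h
  obtain ⟨b, y, hy, hq', hd'⟩ := h'
  -- With `b u = x w`, the product `a x⁻¹ b y⁻¹` becomes `(a w) (y u)⁻¹`.
  obtain ⟨w, u, hu, hw⟩ := hX b x hx
  refine ⟨a * w, y * u, mul_mem hy hu, ?_, ?_⟩
  · rw [map_mul, ← mul_assoc, mul_assoc q, hq', mul_assoc, ← map_mul, hw, map_mul, ← mul_assoc, hq,
      map_mul]
  · have hw' := congrArg Subtype.val hw
    push_cast at hw' ⊢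
    have hdd : monomial σ N (d * d') = monomial σ 0 d * monomial σ N d' := by
      simp [monomial_mul_monomial]
    rw [← mul_assoc, hd, mul_assoc, ← hw', ← mul_assoc, ← monomial_zero_mul_monomial_one,
      mul_assoc (monomial σ 0 d), hd', hdd]
    simp only [mul_assoc]

theorem eq_zero (hι : ∀ x ∈ X, IsUnit (ι x)) (h : IntertwinesAt X ι N 0 q) : q = 0 := by
  obtain ⟨a, x, hx, hq, hd⟩ := h
  rw [monomial_zero, zero_mul] at hd
  have ha : a = 0 := Subtype.ext (eq_zero_of_monomial_one_mul_eq_zero σ hd)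
  rwa [ha, map_zero, (hι x hx).mul_left_eq_zero] at hq

theorem lift (hX : IsRightOre X) {v : ℕ → D} {w : ℕ → Q} (h : ∀ i, IntertwinesAt X ι N (v i) (w i))
    (p : FreeAlgebra k ℕ) :
    IntertwinesAt X ι N (FreeAlgebra.lift k v p) (FreeAlgebra.lift k w p) := by
  induction p using FreeAlgebra.induction with
  | grade0 c => simpa using of_algebraMap c
  | grade1 i => simpa using h i
  | add a b ha hb => simpa using ha.add hX hb
  | mul a b ha hb => simpa using ha.mul hX hb

end IntertwinesAt

end SkewPolyRing

open SkewPolyRing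

/-- In a degree `N` whose torsion-free quotient has maximal length, every fraction of degree zero
is intertwined by `tᴺ` with an element of `D`. -/
theorem exists_forall_intertwinesAt {k D : Type*} [Field k] [Ring D] [Algebra k D]
    [IsSemisimpleRing D] {σ : D ≃ₐ[k] D} {A : Subalgebra k (SkewPolyRing σ)}
    [GradedAlgebra (gradedPiece A)] (hOre : IsRightOre (homogeneousRegular (gradedPiece A)))
    {Q : Type*} [Ring Q] [Algebra k Q] {ι : A →ₐ[k] Q}
    (h : IsGradedQuotientRing (gradedPiece A) ι) :
    ∃ N, ∀ q ∈ h.degreeZero, ∃ d, IntertwinesAt (homogeneousRegular (gradedPiece A)) ι N d q := by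
  obtain ⟨N, hN⟩ := exists_index_forall_right_mul_surjective
    (torsionCoeff A (homogeneousRegular (gradedPiece A)) hOre)
  refine ⟨N, ?_⟩
  rintro q ⟨p, a, ⟨a₀, ha⟩, x, ⟨e, he⟩, hx, hq⟩
  -- Surjectivity modulo torsion in degree `N + p`: `z` kills `d tᴺ x - tᴺ a`, so enlarging the
  -- fraction to `(a z) (x z)⁻¹` gives an exact relation.
  obtain ⟨d, z, hz, hd⟩ := hN (N + p) ((σ ^ N) e)
    (mem_torsionCoeff_iff_mul_mem A _ hOre hx he N) ((σ ^ N) a₀)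
  refine ⟨d, a * z, x * z, mul_mem hx hz, by rw [map_mul, ← mul_assoc, hq, map_mul], ?_⟩
  rw [monomial_sub, sub_mul, sub_eq_zero, ← monomial_mul_monomial,
    ← one_mul ((σ ^ N) a₀), ← monomial_mul_monomial, ha, he] at hd
  push_cast
  rw [← mul_assoc, ← mul_assoc]
  exact hd.symm

theorem mainTheorem10 {k D : Type*} [Field k] [Ring D] [Algebra k D]
    [IsSemisimpleRing D] [Module.Finite (Subalgebra.center k D) D]
    (σ : D ≃ₐ[k] D)
    (A : Subalgebra k (SkewPolyRing σ)) [GradedAlgebra (SkewPolyRing.gradedPiece A)]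
    (hsemiprime : IsSemiprimeRing A) (hnoeth : IsTwoSidedNoetherianRing A)
    (hOre : IsRightOre (homogeneousRegular (SkewPolyRing.gradedPiece A))) :
    IsBirationallyPI (SkewPolyRing.gradedPiece A) := by
  obtain ⟨Q, _, _, ι, h⟩ := exists_isGradedQuotientRing _ hOre
  obtain ⟨p, hp, hD⟩ := isPIAlgebra_of_finite_center k D
  obtain ⟨N, hN⟩ := exists_forall_intertwinesAt hOre h
  refine ⟨Q, _, _, ι, h, p, hp, fun v => Subtype.ext ?_⟩
  choose d hd using fun i => hN (v i) (v i).2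
  have hv := IntertwinesAt.lift hOre hd p
  rw [hD] at hv
  rw [ZeroMemClass.coe_zero, ← hv.eq_zero h.isUnit]
  -- Evaluating in `Q(A)₀` and then including into `Q` agrees with evaluating in `Q`.
  exact DFunLike.congr_fun (FreeAlgebra.hom_ext (by ext; simp) :
    h.degreeZero.val.comp (FreeAlgebra.lift k v) = FreeAlgebra.lift k fun i => (v i : Q)) p
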